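/- (Continuous case.) Let $V:\mathbb R\to\mathbb R$ be measurable with $\int_{-\infty}^{\infty}(1+|x|)\,|V(x)|\,dx<\infty$, $V$ not almost everywhere zero, and $\int_{-\infty}^{\infty}V(x)\,dx\ge 0$ (the value $0$ is allowed). For $\sigma>0$ let $H$ be the operator in $L^2(\mathbb R)$ given by $$H\psi=\psi''+\sigma V\psi,$$ with domain consisting of all $\psi\in L^2(\mathbb R)$ such that $\psi$ and $\psi'$ are locally absolutely continuous and $\psi''+\sigma V\psi\in L^2(\mathbb R)$. Then for every $\sigma>0$ the operator $H$ has a positive eigenvalue $\lambda=\lambda(\sigma)>0$, i.e. there is a nonzero $\psi$ in the domain of $H$ with $H\psi=\lambda\psi$. (Lattice case.) Let $V:\mathbb Z\to\mathbb R$ satisfy $\sum_{x\in\mathbb Z}(1+|x|)\,|V(x)|<\infty$, $V\not\equiv0$, and $\sum_{x\in\mathbb Z}V(x)\ge 0$ (the value $0$ is allowed). Then for every $\sigma>0$ the operator $$H\psi(x)=\psi(x-1)+\psi(x+1)-2\psi(x)+\sigma V(x)\psi(x)$$ in $\ell^2(\mathbb Z)$ has a positive eigenvalue $\lambda=\lambda(\sigma)>0$,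 i.e. there is a nonzero $\psi\in\ell^2(\mathbb Z)$ with $H\psi=\lambda\psi$. -/

import Mathlib

open MeasureTheory

noncomputable section

/-- The (complex) Hilbert space `L²(ℝ)` with respect to Lebesgue measure. -/
abbrev L2Line : Type := Lp ℂ 2 (volume : Measure ℝ)

/-- The (complex) Hilbert space `ℓ²(ℤ)`. -/
abbrev L2Lattice : Type := lp (fun _ : ℤ => ℂ) 2

/-- `μ` is an eigenvalue of the (possibly unbounded) operator `T`: there is a nonzero vector `f`
in the domain of `T` with `T f = μ f`. -/
def IsEigenvalue {E : Type*} [AddCommGroup E] [Module ℂ E] (T : E →ₗ.[ℂ] E) (μ : ℂ) : Prop :=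
  ∃ f : T.domain, (f : E) ≠ 0 ∧ T f = μ • (f : E)

/-- `IsLineSolution q f g` says that `f` has a representative `ψ` which is differentiable, whose
derivative `φ = ψ'` is absolutely continuous on every bounded interval, and for which
`ψ'' + q ψ = g` almost everywhere. -/
def IsLineSolution (q : ℝ → ℝ) (f g : ℝ → ℂ) : Prop :=
  ∃ ψ φ : ℝ → ℂ, f =ᵐ[volume] ψ ∧ (∀ x, HasDerivAt ψ (φ x) x) ∧
    (∀ a b, AbsolutelyContinuousOnInterval φ a b) ∧
    ∀ᵐ x, HasDerivAt φ (g x - (q x : ℂ) * ψ x) x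

/-- The graph of the operator `f ↦ f'' + q f` in `L²(ℝ)`, on its maximal domain. -/
def lineGraph (q : ℝ → ℝ) : Submodule ℂ (L2Line × L2Line) where
  carrier := {p | IsLineSolution q p.1 p.2}
  zero_mem' := by
    refine ⟨0, 0, Lp.coeFn_zero _ _ _, fun x => hasDerivAt_const x (0 : ℂ),
      fun a b => ?_, ?_⟩
    · exact (LipschitzWith.const (0 : ℂ)).lipschitzOnWith.absolutelyContinuousOnInterval
    · filter_upwards [Lp.coeFn_zero ℂ 2 (volume : Measure ℝ)] with x hx
      have h : ((0 : L2Line × L2Line).2 : ℝ → ℂ) x = 0 := hx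
      rw [h]
      convert! hasDerivAt_const x (0 : ℂ) using 1
      simp
  add_mem' := by
    rintro ⟨f₁, g₁⟩ ⟨f₂, g₂⟩ ⟨ψ₁, φ₁, h₁, d₁, a₁, e₁⟩ ⟨ψ₂, φ₂, h₂, d₂, a₂, e₂⟩
    refine ⟨ψ₁ + ψ₂, φ₁ + φ₂, (Lp.coeFn_add _ _).trans (h₁.add h₂),
      fun x => (d₁ x).add (d₂ x), fun a b => (a₁ a b).add (a₂ a b), ?_⟩
    filter_upwards [e₁, e₂, Lp.coeFn_add g₁ g₂] with x k₁ k₂ hx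
    convert! k₁.add k₂ using 1
    simp only [Prod.mk_add_mk, Pi.add_apply] at hx ⊢
    rw [hx]
    ring
  smul_mem' := by
    rintro c ⟨f, g⟩ ⟨ψ, φ, h, d, a, e⟩
    refine ⟨c • ψ, c • φ, (Lp.coeFn_smul _ _).trans (h.const_smul c),
      fun x => (d x).const_smul c, fun s t => (a s t).const_smul c, ?_⟩
    filter_upwards [e, Lp.coeFn_smul c g] with x k hx
    convert! k.const_smul c using 1
    simp only [Prod.smul_mk, Pi.smul_apply, smul_eq_mul] at hx ⊢
    rw [hx]
    ring

theorem lineGraph_singleValued (q : ℝ → ℝ) (p : L2Line × L2Line) (hp : p ∈ lineGraph q)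
    (h0 : p.1 = 0) : p.2 = 0 := by
  obtain ⟨f, g⟩ := p
  obtain ⟨ψ, φ, h, d, -, e⟩ := hp
  simp only at h0 h e ⊢
  subst h0
  have hψ : ψ = 0 := by
    have hc : Continuous ψ := continuous_iff_continuousAt.2 fun x => (d x).continuousAt
    exact (hc.ae_eq_iff_eq volume continuous_zero).1
      (h.symm.trans (Lp.coeFn_zero ℂ 2 (volume : Measure ℝ)))
  subst hψ
  have hφ : φ = 0 := by
    funext x
    exact (d x).unique (hasDerivAt_const x (0 : ℂ))
  subst hφ
  rw [Lp.eq_zero_iff_ae_eq_zero]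
  filter_upwards [e] with x hx
  simpa using hx.unique (hasDerivAt_const x (0 : ℂ))

/-- The Schrödinger operator `H ψ = ψ'' + σ V ψ` in `L²(ℝ)`. Its domain is the maximal one: all
`ψ ∈ L²(ℝ)` such that `ψ` and `ψ'` are locally absolutely continuous and
`ψ'' + σ V ψ ∈ L²(ℝ)`. -/
def lineSchrodinger (σ : ℝ) (V : ℝ → ℝ) : L2Line →ₗ.[ℂ] L2Line :=
  (lineGraph fun x => σ * V x).toLinearPMap

theorem lineSchrodinger_mem_graph_iff (σ : ℝ) (V : ℝ → ℝ) (f g : L2Line) :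
    (f, g) ∈ (lineSchrodinger σ V).graph ↔ IsLineSolution (fun x => σ * V x) f g := by
  rw [lineSchrodinger, Submodule.toLinearPMap_graph_eq _ (lineGraph_singleValued _)]
  rfl

/-- The graph of the operator `(H ψ)(x) = ψ(x - 1) + ψ(x + 1) - 2 ψ(x) + σ V(x) ψ(x)` in
`ℓ²(ℤ)`, on its maximal domain (which is all of `ℓ²(ℤ)` for bounded `V`). -/
def latticeGraph (σ : ℝ) (V : ℤ → ℝ) : Submodule ℂ (L2Lattice × L2Lattice) where
  carrier := {p | ∀ x : ℤ,
    p.2 x = p.1 (x - 1) + p.1 (x + 1) - 2 * p.1 x + (σ * V x : ℂ) * p.1 x}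
  zero_mem' := by intro x; simp
  add_mem' := by
    intro p r hp hr x
    simp only [Set.mem_ofPred_eq, Prod.fst_add, Prod.snd_add, lp.coeFn_add, Pi.add_apply] at hp hr ⊢
    rw [hp x, hr x]
    ring
  smul_mem' := by
    intro c p hp x
    simp only [Set.mem_ofPred_eq, Prod.smul_fst, Prod.smul_snd, lp.coeFn_smul, Pi.smul_apply,
      smul_eq_mul] at hp ⊢
    rw [hp x]
    ring

theorem latticeGraph_singleValued (σ : ℝ) (V : ℤ → ℝ) (p : L2Lattice × L2Lattice)
    (hp : p ∈ latticeGraph σ V) (h0 : p.1 = 0) : p.2 = 0 := by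
  ext x
  have h := hp x
  rw [h0] at h
  simpa using h

/-- The lattice Schrödinger operator `H ψ = ψ'' + σ V ψ` in `ℓ²(ℤ)`, where
`ψ''(x) = ψ(x - 1) + ψ(x + 1) - 2 ψ(x)`. -/
def latticeSchrodinger (σ : ℝ) (V : ℤ → ℝ) : L2Lattice →ₗ.[ℂ] L2Lattice :=
  (latticeGraph σ V).toLinearPMap

theorem latticeSchrodinger_mem_graph_iff (σ : ℝ) (V : ℤ → ℝ) (f g : L2Lattice) :
    (f, g) ∈ (latticeSchrodinger σ V).graph ↔
      ∀ x : ℤ, g x = f (x - 1) + f (x + 1) - 2 * f x + (σ * V x : ℂ) * f x := by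
  rw [latticeSchrodinger, Submodule.toLinearPMap_graph_eq _ (latticeGraph_singleValued σ V)]
  rfl

end

/-! Both cases reduce to the integral equation `ψ = g_k * (σ V ψ)` with `g_k` the decaying Green
function: `exp (-k|t|) / (2k)` on the line (eigenvalue `k ^ 2`), `exp (-k|n|) / (2 sinh k)` on the
lattice (eigenvalue `2 cosh k - 2`). The kernel `exp (-k|s - t|) / (2k)` is the Gram matrix of
one-sided exponentials `e_t` in `L²(ℝ)` (`inner_expVec`), so `ψ t = ⟪e_t, u⟫` solves the equation as
soon as `u` is fixed by the compact symmetric operator `kernelOp`. The lattice uses the same vectors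
at integer points, with the factor `c = k / sinh k`.

A fixed vector comes from a continuity argument in `k` (`exists_fixed_of_family`): the operator has
norm at most `1` for large `k`, so if its form exceeds `‖u‖ ^ 2` for some `k`, then at the supremum
of such `k` the top of the spectrum is exactly `1`.

Small `k` supplies the excess (`exists_kernelOp_gt`). A trial vector is seen by the `e_t` as nearly
`1 + δ η`, where `η` is half a difference of two translates of `|t|`. In the limit, form minus
squared norm is `∫ V + 2 δ ∫ V η + O(δ ^ 2)`, positive for a suitable small `δ` even if `∫ V = 0`,
provided `∫ V η ≠ 0`. Some `η` satisfies this, since otherwise `V * |x|` is constant and its second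
derivative (or difference) `2 V` vanishes. -/

open Filter Topology Set

/-! ### Fixed vectors of compact symmetric operators -/

section Abstract

variable {E : Type*} [NormedAddCommGroup E] [InnerProductSpace ℝ E]

/-- Cauchy–Schwarz for the positive form `‖u‖² - ⟪K u, u⟫`. -/
theorem norm_sub_sq_le_of_inner_le (K : E →L[ℝ] E)
    (hs : ∀ u v, inner ℝ (K u) v = inner ℝ u (K v))
    (hle : ∀ u, inner ℝ (K u) u ≤ ‖u‖ ^ 2) (u : E) :
    ‖K u - u‖ ^ 2 ≤ (1 + ‖K‖) * (‖u‖ ^ 2 - inner ℝ (K u) u) := by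
  set w := K u - u with hw
  have hM : 0 < 1 + ‖K‖ := by positivity
  -- Nonnegativity of the form at `u + t • w` gives `2 t ‖w‖² - t² (1 + ‖K‖) ‖w‖² ≤ ‖u‖² - ⟪K u,
  -- u⟫`; this `t` maximises the left side.
  set t : ℝ := (1 + ‖K‖)⁻¹ with ht
  have h1 := hle (u + t • w)
  have hKw : -(‖K‖ * ‖w‖ ^ 2) ≤ inner ℝ (K w) w := by
    have h := abs_real_inner_le_norm (K w) w
    have h' := K.le_opNorm w
    have := neg_le_of_abs_le h
    nlinarith [norm_nonneg w]
  have h2 : inner ℝ (K w) u = inner ℝ w (K u) := hs w u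
  have h3 : inner ℝ (K u) w = inner ℝ w (K u) := real_inner_comm _ _
  have h4 : inner ℝ w (K u) - inner ℝ w u = ‖w‖ ^ 2 := by
    rw [← inner_sub_right, ← hw, real_inner_self_eq_norm_sq]
  have h5 : inner ℝ u w = inner ℝ w u := real_inner_comm _ _
  rw [← real_inner_self_eq_norm_sq (u + t • w)] at h1
  simp only [map_add, map_smul, inner_add_left, inner_add_right, real_inner_smul_left,
    real_inner_smul_right, h2, h3, h5, real_inner_self_eq_norm_sq] at h1
  rw [norm_smul, mul_pow, Real.norm_eq_abs, sq_abs] at h1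
  have h6 : 2 * t * ‖w‖ ^ 2 - t ^ 2 * (1 + ‖K‖) * ‖w‖ ^ 2 ≤ ‖u‖ ^ 2 - inner ℝ (K u) u := by
    have h9 := mul_le_mul_of_nonneg_left hKw (sq_nonneg t)
    have h10 : t * (inner ℝ w (K u) - inner ℝ w u) = t * ‖w‖ ^ 2 := by rw [h4]
    linarith
  have h7 : t * (1 + ‖K‖) = 1 := inv_mul_cancel₀ hM.ne'
  have h8 : t * ‖w‖ ^ 2 ≤ ‖u‖ ^ 2 - inner ℝ (K u) u := by
    calc t * ‖w‖ ^ 2 = 2 * t * ‖w‖ ^ 2 - t * (t * (1 + ‖K‖)) * ‖w‖ ^ 2 := by rw [h7]; ring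
      _ = 2 * t * ‖w‖ ^ 2 - t ^ 2 * (1 + ‖K‖) * ‖w‖ ^ 2 := by ring
      _ ≤ _ := h6
  calc ‖w‖ ^ 2 = (1 + ‖K‖) * (t * ‖w‖ ^ 2) := by
        rw [← mul_assoc, mul_comm _ t, h7, one_mul]
    _ ≤ _ := by gcongr

/-- A compact symmetric operator whose quadratic form has supremum `1` on the unit sphere has a
fixed vector. -/
theorem exists_fixed_of_compact [CompleteSpace E] (K : E →L[ℝ] E) (hc : IsCompactOperator K)
    (hs : ∀ u v, inner ℝ (K u) v = inner ℝ u (K v))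
    (hle : ∀ u, inner ℝ (K u) u ≤ ‖u‖ ^ 2)
    (happ : ∀ ε > 0, ∃ u, (1 - ε) * ‖u‖ ^ 2 < inner ℝ (K u) u) :
    ∃ u, u ≠ 0 ∧ K u = u := by
  by_contra! hne
  have hev : ¬ Module.End.HasEigenvalue (K : Module.End ℝ E) 1 := by
    intro h
    obtain ⟨v, hv⟩ := h.exists_hasEigenvector
    exact hne v hv.2 (by simpa using hv.apply_eq_smul)
  -- Fredholm alternative: without the eigenvalue `1`, `K - 1` is bounded below, which
  -- near-maximisers of the form contradict.
  obtain ⟨C, hC⟩ := hc.antilipschitz_of_not_hasEigenvalue one_ne_zero hev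
  set A : ℝ := C ^ 2 * (1 + ‖K‖) with hA
  have hA0 : 0 ≤ A := by positivity
  obtain ⟨u, hu⟩ := happ (A + 1)⁻¹ (by positivity)
  have h1 : ‖u‖ ≤ C * ‖K u - u‖ := by
    have := hC.le_mul_dist u 0
    simpa [dist_eq_norm] using this
  have h2 := norm_sub_sq_le_of_inner_le K hs hle u
  have h3 : ‖u‖ ^ 2 ≤ A * (‖u‖ ^ 2 - inner ℝ (K u) u) := by
    calc ‖u‖ ^ 2 ≤ (C * ‖K u - u‖) ^ 2 := by gcongr
      _ = C ^ 2 * ‖K u - u‖ ^ 2 := by ring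
      _ ≤ C ^ 2 * ((1 + ‖K‖) * (‖u‖ ^ 2 - inner ℝ (K u) u)) := by gcongr
      _ = _ := by rw [hA]; ring
  have h4 : ‖u‖ ^ 2 - inner ℝ (K u) u < (A + 1)⁻¹ * ‖u‖ ^ 2 := by linarith
  have h5 : (A + 1) * (‖u‖ ^ 2 - inner ℝ (K u) u) < ‖u‖ ^ 2 := by
    have := mul_lt_mul_of_pos_left h4 (show 0 < A + 1 by positivity)
    rwa [← mul_assoc, mul_inv_cancel₀ (by positivity), one_mul] at this
  linarith [hle u]

/-- For a norm continuous family of compact symmetric operators whose quadratic form exceeds `1`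
at some parameter and is small for large parameters, some member has a fixed vector. -/
theorem exists_fixed_of_family [CompleteSpace E] (K : ℝ → E →L[ℝ] E)
    (hcont : ContinuousOn K (Ioi 0))
    (hc : ∀ k, 0 < k → IsCompactOperator (K k))
    (hs : ∀ k, 0 < k → ∀ u v, inner ℝ (K k u) v = inner ℝ u (K k v))
    (b : ℝ) (hb : ∀ k, 0 < k → b ≤ k → ‖K k‖ ≤ 1)
    (hbig : ∃ k, 0 < k ∧ ∃ u, ‖u‖ ^ 2 < inner ℝ (K k u) u) :
    ∃ k, 0 < k ∧ ∃ u, u ≠ 0 ∧ K k u = u := by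
  -- At `s = sSup S` the form is at most `‖u‖ ^ 2`, as a strict excess would persist slightly to the
  -- right of `s`; members of `S` close to `s` show that the bound is nearly attained.
  set S : Set ℝ := {k | 0 < k ∧ ∃ u, ‖u‖ ^ 2 < inner ℝ (K k u) u} with hS
  obtain ⟨k₀, hk₀⟩ : S.Nonempty := hbig
  have hbdd : BddAbove S := by
    refine ⟨b, fun k hk => ?_⟩
    by_contra! hlt
    obtain ⟨hk0, u, hu⟩ := hk
    have h1 := real_inner_le_norm (K k u) u
    have h2 := (K k).le_of_opNorm_le (hb k hk0 hlt.le) u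
    nlinarith [norm_nonneg u]
  set s := sSup S with hs'
  have hs0 : 0 < s := hk₀.1.trans_le (le_csSup hbdd hk₀)
  have hKs : ContinuousAt K s := hcont.continuousAt (Ioi_mem_nhds hs0)
  refine ⟨s, hs0, exists_fixed_of_compact (K s) (hc s hs0) (hs s hs0) ?_ ?_⟩
  · intro u
    by_contra! hu
    have hcu : ContinuousAt (fun k => inner ℝ (K k u) u) s :=
      ContinuousAt.inner (hKs.clm_apply continuousAt_const) continuousAt_const
    have hev := hcu.eventually (lt_mem_nhds hu)
    obtain ⟨k, hk, hks⟩ := ((hev.filter_mono nhdsWithin_le_nhds).and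
      (self_mem_nhdsWithin : Ioi s ∈ 𝓝[>] s)).exists
    have hks' : s < k := hks
    exact absurd (le_csSup hbdd (show k ∈ S from ⟨hs0.trans hks', u, hk⟩)) (not_le.2 hks')
  · intro ε hε
    obtain ⟨δ, hδ, hball⟩ := Metric.continuousAt_iff.1 hKs ε hε
    obtain ⟨k, hkS, hk⟩ := exists_lt_of_lt_csSup ⟨k₀, hk₀⟩ (sub_lt_self s hδ)
    have hks := le_csSup hbdd hkS
    have hd : dist (K k) (K s) < ε := hball (by rw [Real.dist_eq, abs_lt]; constructor <;> linarith)
    obtain ⟨-, u, hu⟩ := hkS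
    refine ⟨u, ?_⟩
    have h1 : inner ℝ (K k u) u - inner ℝ (K s u) u ≤ ε * ‖u‖ ^ 2 := by
      rw [← inner_sub_left, ← sub_apply]
      have h2 := real_inner_le_norm ((K k - K s) u) u
      have h3 := (K k - K s).le_of_opNorm_le ((dist_eq_norm _ _).symm.le.trans hd.le) u
      nlinarith [norm_nonneg u]
    linarith

variable {X : Type*} [MeasurableSpace X] {ν : Measure X}

/-- The Bochner integral of compact operators is compact. -/
theorem isCompactOperator_integral [CompleteSpace E] (T : X → E →L[ℝ] E) (hT : Integrable T ν)
    (hc : ∀ x, IsCompactOperator (T x)) : IsCompactOperator (∫ x, T x ∂ν : E →L[ℝ] E) := by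
  set S : Submodule ℝ (E →L[ℝ] E) := compactOperator (RingHom.id ℝ) E E
  have hS : IsClosed (S : Set (E →L[ℝ] E)) := isClosed_setOfPred_isCompactOperator
  by_contra hmem
  -- Compact operators form a closed subspace. A functional bounded above on a subspace vanishes
  -- there, and it passes through the integral.
  obtain ⟨f, hf, hfS⟩ : ∃ f : (E →L[ℝ] E) →L[ℝ] ℝ, f (∫ x, T x ∂ν) ≠ 0 ∧ ∀ s ∈ S, f s = 0 := by
    obtain ⟨f, u, hfu, hux⟩ := geometric_hahn_banach_closed_point S.convex hS hmem
    have hz : ∀ s ∈ S, f s = 0 := by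
      intro s hs
      by_contra hne
      have := hfu (((u + 1) / f s) • s) (S.smul_mem _ hs)
      rw [map_smul, smul_eq_mul, div_mul_cancel₀ _ hne] at this
      linarith
    refine ⟨f, fun h0 => ?_, hz⟩
    have := hfu 0 S.zero_mem
    rw [map_zero] at this
    linarith
  apply hf
  rw [← f.integral_comp_comm hT]
  simp [fun x => hfS (T x) (hc x)]

theorem isCompactOperator_rankOne (x y : E) :
    IsCompactOperator (InnerProductSpace.rankOne ℝ x y : E →L[ℝ] E) := by
  rw [InnerProductSpace.rankOne_def']
  have h : IsCompactOperator (ContinuousLinearMap.toSpanSingleton ℝ x) :=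
    isCompactOperator_of_locallyCompactSpace_rng _
  exact h.comp_clm (innerSL ℝ y)

end Abstract

/-! ### Exponential vectors factorising the Green function -/

/-- The function `y ↦ exp (-k (t - y))` on `(-∞, t]`, extended by zero. -/
noncomputable def expTail (k t : ℝ) : ℝ → ℝ := (Iic t).indicator fun y => Real.exp (k * (y - t))

theorem expTail_mul (k l s t : ℝ) :
    (fun y => expTail k s y * expTail l t y) = (Iic (min s t)).indicator fun y =>
      Real.exp (-(k * s + l * t)) * Real.exp ((k + l) * y) := by
  funext y
  by_cases hs : y ≤ s <;> by_cases ht : y ≤ t <;> simp [expTail, hs, ht]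
  rw [← Real.exp_add, ← Real.exp_add]
  ring_nf

theorem integrable_expTail_mul {k l : ℝ} (hk : 0 < k) (hl : 0 < l) (s t : ℝ) :
    Integrable (fun y => expTail k s y * expTail l t y) := by
  rw [expTail_mul, integrable_indicator_iff measurableSet_Iic]
  exact (integrableOn_exp_mul_Iic (add_pos hk hl) _).const_mul _

theorem integral_expTail_mul {k l : ℝ} (hk : 0 < k) (hl : 0 < l) (s t : ℝ) :
    ∫ y, expTail k s y * expTail l t y =
      Real.exp ((k + l) * min s t - (k * s + l * t)) / (k + l) := by
  rw [expTail_mul, integral_indicator measurableSet_Iic, integral_const_mul,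
    integral_exp_mul_Iic (add_pos hk hl), sub_eq_neg_add, Real.exp_add, mul_div_assoc]

theorem memLp_expTail {k : ℝ} (hk : 0 < k) (t : ℝ) : MemLp (expTail k t) 2 volume := by
  rw [memLp_two_iff_integrable_sq]
  · simpa only [sq] using integrable_expTail_mul hk hk t t
  · exact (Measurable.indicator (by fun_prop) measurableSet_Iic).aestronglyMeasurable

open Classical in
/-- `expTail k t` as an element of `L²(ℝ)` (zero for `k ≤ 0`). -/
noncomputable def expVec (k t : ℝ) : Lp ℝ 2 (volume : Measure ℝ) :=
  if hk : 0 < k then (memLp_expTail hk t).toLp else 0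

/-- Two different rates are allowed because continuity in the rate is read off from these inner
products. -/
theorem inner_expVec_expVec {k l : ℝ} (hk : 0 < k) (hl : 0 < l) (s t : ℝ) :
    inner ℝ (expVec k s) (expVec l t) =
      Real.exp ((k + l) * min s t - (k * s + l * t)) / (k + l) := by
  rw [expVec, expVec, dif_pos hk, dif_pos hl, L2.inner_def, ← integral_expTail_mul hk hl]
  apply integral_congr_ae
  filter_upwards [(memLp_expTail hk s).coeFn_toLp, (memLp_expTail hl t).coeFn_toLp] with y h1 h2
  rw [h1, h2]
  simp [mul_comm]

/-- This is the Green function of `-d²/dt² + k²`. Factorising it, rather than `V`, yields a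
symmetric operator even though `V` changes sign. -/
theorem inner_expVec {k : ℝ} (hk : 0 < k) (s t : ℝ) :
    inner ℝ (expVec k s) (expVec k t) = Real.exp (-(k * |s - t|)) / (2 * k) := by
  rw [inner_expVec_expVec hk hk, ← two_mul]
  congr 2
  rcases le_total s t with h | h
  · rw [min_eq_left h, abs_of_nonpos (by linarith)]; ring
  · rw [min_eq_right h, abs_of_nonneg (by linarith)]; ring

theorem norm_expVec_sq {k : ℝ} (hk : 0 < k) (t : ℝ) : ‖expVec k t‖ ^ 2 = 1 / (2 * k) := by
  rw [← real_inner_self_eq_norm_sq, inner_expVec hk]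
  simp

theorem tendsto_of_norm_sub_sq {E α : Type*} [NormedAddCommGroup E] {l : Filter α} {f : α → E}
    {a : E} (h : Tendsto (fun x => ‖f x - a‖ ^ 2) l (𝓝 0)) : Tendsto f l (𝓝 a) := by
  rw [tendsto_iff_norm_sub_tendsto_zero]
  have := h.sqrt
  simpa using this

theorem continuous_expVec {k : ℝ} (hk : 0 < k) : Continuous (expVec k) := by
  rw [continuous_iff_continuousAt]
  intro t
  apply tendsto_of_norm_sub_sq
  have h : (fun s => ‖expVec k s - expVec k t‖ ^ 2) =
      fun s => 1 / (2 * k) - 2 * (Real.exp (-(k * |s - t|)) / (2 * k)) + 1 / (2 * k) := by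
    funext s
    rw [norm_sub_sq_real, norm_expVec_sq hk, norm_expVec_sq hk, inner_expVec hk]
  rw [h]
  have hc : Continuous fun s =>
      1 / (2 * k) - 2 * (Real.exp (-(k * |s - t|)) / (2 * k)) + 1 / (2 * k) := by fun_prop
  convert hc.tendsto t using 2
  simp
  ring

theorem continuousAt_expVec_param {k : ℝ} (hk : 0 < k) (t : ℝ) :
    ContinuousAt (fun k => expVec k t) k := by
  apply tendsto_of_norm_sub_sq
  have h : (fun l => ‖expVec l t - expVec k t‖ ^ 2) =ᶠ[𝓝 k]
      fun l => 1 / (2 * l) - 2 * (1 / (l + k)) + 1 / (2 * k) := by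
    filter_upwards [Ioi_mem_nhds hk] with l hl
    rw [norm_sub_sq_real, norm_expVec_sq hk, norm_expVec_sq hl, inner_expVec_expVec hl hk]
    simp [add_mul]
  refine Tendsto.congr' h.symm ?_
  have hc : ContinuousAt (fun l => 1 / (2 * l) - 2 * (1 / (l + k)) + 1 / (2 * k)) k := by
    fun_prop (disch := positivity)
  convert hc.tendsto using 2
  field_simp
  ring

/-! ### The compact symmetric operator attached to the integral equation -/

section Operator

variable {X : Type*} [MeasurableSpace X] {ν : Measure X} {p V : X → ℝ}

/-- The operator `u ↦ c ∫ V(x) ⟪e_{p x}, u⟫ e_{p x} dν(x)` with `e_t = expVec k t`. -/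
noncomputable def kernelOp (ν : Measure X) (p V : X → ℝ) (c k : ℝ) :
    Lp ℝ 2 (volume : Measure ℝ) →L[ℝ] Lp ℝ 2 (volume : Measure ℝ) :=
  ∫ x, (c * V x) • InnerProductSpace.rankOne ℝ (expVec k (p x)) (expVec k (p x)) ∂ν

theorem continuous_rankOne_expVec {k : ℝ} (hk : 0 < k) : Continuous fun t =>
    (InnerProductSpace.rankOne ℝ (expVec k t) (expVec k t) :
      Lp ℝ 2 (volume : Measure ℝ) →L[ℝ] Lp ℝ 2 (volume : Measure ℝ)) :=
  ((InnerProductSpace.rankOne ℝ).continuous.comp (continuous_expVec hk)).clm_apply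
    (continuous_expVec hk)

theorem norm_rankOne_expVec {k : ℝ} (hk : 0 < k) (t : ℝ) :
    ‖(InnerProductSpace.rankOne ℝ (expVec k t) (expVec k t) :
      Lp ℝ 2 (volume : Measure ℝ) →L[ℝ] Lp ℝ 2 (volume : Measure ℝ))‖ = 1 / (2 * k) := by
  rw [InnerProductSpace.norm_rankOne, ← sq, norm_expVec_sq hk]

theorem integrable_kernelOp (hp : Measurable p) (hV : Integrable V ν) (c : ℝ) {k : ℝ}
    (hk : 0 < k) : Integrable (fun x => (c * V x) •
      (InnerProductSpace.rankOne ℝ (expVec k (p x)) (expVec k (p x)) :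
        Lp ℝ 2 (volume : Measure ℝ) →L[ℝ] Lp ℝ 2 (volume : Measure ℝ))) ν := by
  have hm : AEStronglyMeasurable (fun x =>
      (InnerProductSpace.rankOne ℝ (expVec k (p x)) (expVec k (p x)) :
        Lp ℝ 2 (volume : Measure ℝ) →L[ℝ] Lp ℝ 2 (volume : Measure ℝ))) ν :=
    ((continuous_rankOne_expVec hk).stronglyMeasurable.comp_measurable hp).aestronglyMeasurable
  refine ((hV.const_mul c).norm.mul_const (1 / (2 * k))).mono'
    ((hV.const_mul c).aestronglyMeasurable.smul hm) (Eventually.of_forall fun x => ?_)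
  rw [norm_smul, norm_rankOne_expVec hk]

theorem kernelOp_apply (hp : Measurable p) (hV : Integrable V ν) (c : ℝ) {k : ℝ} (hk : 0 < k)
    (u : Lp ℝ 2 (volume : Measure ℝ)) : kernelOp ν p V c k u =
      ∫ x, (c * V x * inner ℝ (expVec k (p x)) u) • expVec k (p x) ∂ν := by
  rw [kernelOp, ContinuousLinearMap.integral_apply (integrable_kernelOp hp hV c hk)]
  simp [mul_smul]

theorem integrable_kernelOp_apply (hp : Measurable p) (hV : Integrable V ν) (c : ℝ) {k : ℝ}
    (hk : 0 < k) (u : Lp ℝ 2 (volume : Measure ℝ)) :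
    Integrable (fun x => (c * V x * inner ℝ (expVec k (p x)) u) • expVec k (p x)) ν := by
  have := (integrable_kernelOp hp hV c hk).apply_continuousLinearMap u
  simpa [mul_smul] using this

theorem inner_kernelOp (hp : Measurable p) (hV : Integrable V ν) (c : ℝ) {k : ℝ} (hk : 0 < k)
    (u v : Lp ℝ 2 (volume : Measure ℝ)) : inner ℝ v (kernelOp ν p V c k u) =
      ∫ x, c * V x * inner ℝ (expVec k (p x)) u * inner ℝ (expVec k (p x)) v ∂ν := by
  rw [kernelOp_apply hp hV c hk, ← integral_inner (integrable_kernelOp_apply hp hV c hk u)]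
  simp only [real_inner_smul_right, real_inner_comm v]

theorem kernelOp_symm (hp : Measurable p) (hV : Integrable V ν) (c : ℝ) {k : ℝ} (hk : 0 < k)
    (u v : Lp ℝ 2 (volume : Measure ℝ)) :
    inner ℝ (kernelOp ν p V c k u) v = inner ℝ u (kernelOp ν p V c k v) := by
  rw [real_inner_comm, inner_kernelOp hp hV c hk, inner_kernelOp hp hV c hk]
  congr 1
  funext x
  ring

theorem isCompactOperator_kernelOp (hp : Measurable p) (hV : Integrable V ν) (c : ℝ) {k : ℝ}
    (hk : 0 < k) : IsCompactOperator (kernelOp ν p V c k) :=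
  isCompactOperator_integral _ (integrable_kernelOp hp hV c hk) fun _ =>
    (compactOperator (RingHom.id ℝ) _ _).smul_mem _ (isCompactOperator_rankOne _ _)

theorem norm_kernelOp_le (c : ℝ) {k : ℝ} (hk : 0 < k) :
    ‖kernelOp ν p V c k‖ ≤ |c| * (∫ x, |V x| ∂ν) / (2 * k) := by
  refine (norm_integral_le_integral_norm _).trans (le_of_eq ?_)
  simp only [norm_smul, norm_rankOne_expVec hk, Real.norm_eq_abs, abs_mul]
  rw [integral_mul_const, integral_const_mul, mul_one_div]

theorem continuousOn_kernelOp (hp : Measurable p) (hV : Integrable V ν) {c : ℝ → ℝ}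
    (hc : ContinuousOn c (Ioi 0)) :
    ContinuousOn (fun k => kernelOp ν p V (c k) k) (Ioi 0) := by
  intro k hk
  have hk : 0 < k := hk
  have hck : ContinuousAt c k := hc.continuousAt (Ioi_mem_nhds hk)
  have hcb : ∀ᶠ l in 𝓝 k, |c l| < |c k| + 1 :=
    hck.abs.eventually (gt_mem_nhds (lt_add_one _))
  have hlk : ∀ᶠ l in 𝓝 k, k / 2 < l := lt_mem_nhds (half_lt_self hk)
  apply ContinuousAt.continuousWithinAt
  -- For `l > k / 2` the rank-one norm `1 / (2 l)` is below `1 / k`.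
  refine continuousAt_of_dominated (bound := fun x => (|c k| + 1) * |V x| * (1 / k)) ?_ ?_ ?_ ?_
  · filter_upwards [hlk] with l hl
    exact (integrable_kernelOp hp hV (c l) (by linarith)).aestronglyMeasurable
  · filter_upwards [hlk, hcb] with l hl hcl
    refine Eventually.of_forall fun x => ?_
    rw [norm_smul, norm_rankOne_expVec (by linarith), Real.norm_eq_abs, abs_mul]
    have hl0 : 0 < l := by linarith
    gcongr
    linarith
  · exact (hV.abs.const_mul _).mul_const _
  · refine Eventually.of_forall fun x => ?_
    have h := continuousAt_expVec_param hk (p x)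
    exact (hck.mul continuousAt_const).smul
      (((InnerProductSpace.rankOne ℝ).continuous.continuousAt.comp h).clm_apply h)

end Operator

/-! ### Trial vectors and their limits as `k → 0` -/

theorem tendsto_one_sub_exp_div (a : ℝ) :
    Tendsto (fun k => (1 - Real.exp (-(k * a))) / k) (𝓝[>] 0) (𝓝 a) := by
  have h : HasDerivAt (fun k => -Real.exp (-(k * a))) a 0 := by
    have := (((hasDerivAt_id (0 : ℝ)).mul_const a).neg.exp).neg
    convert! this using 1
    simp
  refine h.tendsto_slope_zero_right.congr fun k => ?_
  simp
  ring

theorem abs_exp_neg_sub_exp_neg_le {a b : ℝ} (ha : 0 ≤ a) (hb : 0 ≤ b) :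
    |Real.exp (-a) - Real.exp (-b)| ≤ |a - b| := by
  wlog h : a ≤ b generalizing a b
  · rw [abs_sub_comm, abs_sub_comm a]
    exact this hb ha (le_of_not_ge h)
  rw [abs_of_nonneg (sub_nonneg.2 (Real.exp_le_exp.2 (by linarith))), abs_of_nonpos (by linarith)]
  have h1 : Real.exp (-b) = Real.exp (-a) * Real.exp (a - b) := by
    rw [← Real.exp_add]; ring_nf
  have h2 := Real.add_one_le_exp (a - b)
  have h3 : Real.exp (-a) ≤ 1 := Real.exp_le_one_iff.2 (by linarith)
  have h4 : 0 < Real.exp (-a) := Real.exp_pos _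
  rw [h1]
  nlinarith

theorem abs_exp_abs_sub_le {k : ℝ} (hk : 0 ≤ k) (s t x : ℝ) :
    |Real.exp (-(k * |s - x|)) - Real.exp (-(k * |t - x|))| ≤ k * |s - t| := by
  refine (abs_exp_neg_sub_exp_neg_le (by positivity) (by positivity)).trans ?_
  rw [← mul_sub, abs_mul, abs_of_nonneg hk]
  refine mul_le_mul_of_nonneg_left ?_ hk
  have := abs_abs_sub_abs_le_abs_sub (s - x) (t - x)
  rwa [sub_sub_sub_cancel_right] at this

section Trial

/-- The trial vector representing `exp (-k |t|)` plus a multiple of a difference of two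
translates of the Green function. -/
noncomputable def trialVec (δ z₁ z₂ k : ℝ) : Lp ℝ 2 (volume : Measure ℝ) :=
  (2 * k) • expVec k 0 + δ • (expVec k z₁ - expVec k z₂)

theorem inner_trialVec (δ z₁ z₂ : ℝ) {k : ℝ} (hk : 0 < k) (t : ℝ) :
    inner ℝ (expVec k t) (trialVec δ z₁ z₂ k) = Real.exp (-(k * |t|)) +
      δ * ((Real.exp (-(k * |z₁ - t|)) - Real.exp (-(k * |z₂ - t|))) / (2 * k)) := by
  rw [trialVec, inner_add_right, real_inner_smul_right, real_inner_smul_right, inner_sub_right,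
    inner_expVec hk, inner_expVec hk, inner_expVec hk, sub_zero, abs_sub_comm t, abs_sub_comm t]
  field_simp

theorem norm_trialVec_sq (δ z₁ z₂ : ℝ) {k : ℝ} (hk : 0 < k) :
    ‖trialVec δ z₁ z₂ k‖ ^ 2 = 2 * k +
      2 * δ * (Real.exp (-(k * |z₁|)) - Real.exp (-(k * |z₂|))) +
      δ ^ 2 * ((1 - Real.exp (-(k * |z₁ - z₂|))) / k) := by
  rw [trialVec, norm_add_sq_real, norm_smul, norm_smul, mul_pow, mul_pow, norm_sub_sq_real,
    real_inner_smul_right, real_inner_smul_left, inner_sub_right,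
    norm_expVec_sq hk, norm_expVec_sq hk, norm_expVec_sq hk, inner_expVec hk, inner_expVec hk,
    inner_expVec hk, Real.norm_eq_abs, Real.norm_eq_abs, sq_abs, sq_abs, zero_sub, zero_sub,
    abs_neg, abs_neg]
  field_simp
  ring

/-- The part representing `exp (-k|t|)` has squared norm `2 k`, and the cross term dies because both
exponentials tend to `1`: the constant function costs nothing in the limit. -/
theorem tendsto_norm_trialVec_sq (δ z₁ z₂ : ℝ) :
    Tendsto (fun k => ‖trialVec δ z₁ z₂ k‖ ^ 2) (𝓝[>] 0) (𝓝 (δ ^ 2 * |z₁ - z₂|)) := by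
  have h : Tendsto (fun k => 2 * k +
      2 * δ * (Real.exp (-(k * |z₁|)) - Real.exp (-(k * |z₂|)))) (𝓝[>] 0) (𝓝 0) := by
    have hc : Continuous fun k => 2 * k +
      2 * δ * (Real.exp (-(k * |z₁|)) - Real.exp (-(k * |z₂|))) := by fun_prop
    have := (hc.tendsto 0).mono_left (nhdsWithin_le_nhds (s := Ioi 0))
    simpa using this
  have h2 := h.add ((tendsto_one_sub_exp_div |z₁ - z₂|).const_mul (δ ^ 2))
  rw [zero_add] at h2
  refine h2.congr' ?_
  filter_upwards [self_mem_nhdsWithin] with k hk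
  rw [norm_trialVec_sq δ z₁ z₂ hk]

theorem tendsto_inner_trialVec (δ z₁ z₂ t : ℝ) :
    Tendsto (fun k => inner ℝ (expVec k t) (trialVec δ z₁ z₂ k)) (𝓝[>] 0)
      (𝓝 (1 + δ * ((|z₂ - t| - |z₁ - t|) / 2))) := by
  have h : Tendsto (fun k => Real.exp (-(k * |t|))) (𝓝[>] 0) (𝓝 1) := by
    have hc : Continuous fun k => Real.exp (-(k * |t|)) := by fun_prop
    have := (hc.tendsto 0).mono_left (nhdsWithin_le_nhds (s := Ioi 0))
    simpa using this
  have h2 := h.add ((((tendsto_one_sub_exp_div |z₂ - t|).sub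
    (tendsto_one_sub_exp_div |z₁ - t|)).div_const 2).const_mul δ)
  refine h2.congr' ?_
  filter_upwards [self_mem_nhdsWithin] with k hk
  have hk : 0 < k := hk
  rw [inner_trialVec δ z₁ z₂ hk]
  field_simp
  ring

/-- The bound is free of `k` and `t`, so an integrable `V` suffices for dominated convergence as `k
→ 0`. -/
theorem abs_inner_trialVec_le (δ z₁ z₂ : ℝ) {k : ℝ} (hk : 0 < k) (t : ℝ) :
    |inner ℝ (expVec k t) (trialVec δ z₁ z₂ k)| ≤ 1 + |δ| * (|z₁ - z₂| / 2) := by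
  rw [inner_trialVec δ z₁ z₂ hk]
  refine (abs_add_le _ _).trans ?_
  rw [abs_mul, abs_div, abs_of_pos (show 0 < 2 * k by positivity), Real.abs_exp]
  refine add_le_add (Real.exp_le_one_iff.2 (neg_nonpos.2 (by positivity)))
    (mul_le_mul_of_nonneg_left ?_ (abs_nonneg δ))
  rw [div_le_iff₀ (by positivity)]
  exact (abs_exp_abs_sub_le hk.le _ _ _).trans (le_of_eq (by ring))

end Trial

theorem exists_quadratic_pos {A B C : ℝ} (hA : 0 ≤ A) (hB : B ≠ 0) :
    ∃ δ : ℝ, 0 < A + 2 * δ * B + δ ^ 2 * C := by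
  -- The factor `B` makes the linear term positive; the denominator keeps the quadratic term from
  -- cancelling it.
  refine ⟨B / (1 + |C|), ?_⟩
  have hC : 0 < 1 + |C| := by positivity
  have h1 : 2 * (B / (1 + |C|)) * B + (B / (1 + |C|)) ^ 2 * C =
      B ^ 2 / (1 + |C|) ^ 2 * (2 * (1 + |C|) + C) := by field_simp
  have h2 : 0 < 2 * (1 + |C|) + C := by linarith [neg_abs_le C, abs_nonneg C]
  have h3 : 0 < B ^ 2 / (1 + |C|) ^ 2 * (2 * (1 + |C|) + C) := by positivity
  linarith

/-! ### Solving the integral equation -/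

section Kernel

variable {X : Type*} [MeasurableSpace X] {ν : Measure X} {p V : X → ℝ}

/-- Along the trial vectors the form tends to `∫ V (1 + δ η) ^ 2` and the squared norm to `δ ^ 2 |z₁
- z₂|`. The nonzero first-order term in `δ` decides the comparison when `∫ V = 0`. -/
theorem exists_kernelOp_gt (hp : Measurable p) (hV : Integrable V ν) (hV0 : 0 ≤ ∫ x, V x ∂ν)
    (hnd : ∃ z₁ z₂, ∫ x, V x * (|z₂ - p x| - |z₁ - p x|) ∂ν ≠ 0) {c : ℝ → ℝ}
    (hc1 : Tendsto c (𝓝[>] 0) (𝓝 1)) (hcb : ∀ k, 0 < k → |c k| ≤ 1) :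
    ∃ k, 0 < k ∧ ∃ u, ‖u‖ ^ 2 < inner ℝ (kernelOp ν p V (c k) k u) u := by
  obtain ⟨z₁, z₂, hz⟩ := hnd
  set η : X → ℝ := fun x => (|z₂ - p x| - |z₁ - p x|) / 2 with hη
  have hηm : Measurable η := by fun_prop
  have hηb : ∀ x, ‖η x‖ ≤ |z₂ - z₁| := by
    intro x
    have h := abs_abs_sub_abs_le_abs_sub (z₂ - p x) (z₁ - p x)
    rw [sub_sub_sub_cancel_right] at h
    rw [hη, Real.norm_eq_abs, abs_div, abs_two]
    linarith [abs_nonneg (|z₂ - p x| - |z₁ - p x|)]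
  have hVη : Integrable (fun x => V x * η x) ν :=
    hV.mul_bdd (c := |z₂ - z₁|) hηm.aestronglyMeasurable (Eventually.of_forall hηb)
  have hVη2 : Integrable (fun x => V x * η x * η x) ν :=
    hVη.mul_bdd (c := |z₂ - z₁|) hηm.aestronglyMeasurable (Eventually.of_forall hηb)
  have hB : ∫ x, V x * η x ∂ν ≠ 0 := by
    have : ∫ x, V x * η x ∂ν = (∫ x, V x * (|z₂ - p x| - |z₁ - p x|) ∂ν) / 2 := by
      rw [← integral_div]
      simp only [hη, mul_div_assoc]
    rw [this]
    exact div_ne_zero hz two_ne_zero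
  obtain ⟨δ, hδ⟩ := exists_quadratic_pos hV0 hB
    (C := ∫ x, V x * η x * η x ∂ν - |z₁ - z₂|)
  have hlim : ∫ x, V x * (1 + δ * η x) * (1 + δ * η x) ∂ν =
      ∫ x, V x ∂ν + 2 * δ * ∫ x, V x * η x ∂ν + δ ^ 2 * ∫ x, V x * η x * η x ∂ν := by
    have h1 : Integrable (fun x => V x + 2 * δ * (V x * η x)) ν := hV.add (hVη.const_mul _)
    rw [← integral_const_mul, ← integral_const_mul, ← integral_add hV (hVη.const_mul _),
      ← integral_add h1 (hVη2.const_mul _)]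
    congr 1
    funext x
    ring
  have hQ : Tendsto (fun k => inner ℝ (kernelOp ν p V (c k) k (trialVec δ z₁ z₂ k))
      (trialVec δ z₁ z₂ k)) (𝓝[>] 0) (𝓝 (∫ x, V x * (1 + δ * η x) * (1 + δ * η x) ∂ν)) := by
    set D := 1 + |δ| * (|z₁ - z₂| / 2) with hD
    have h : Tendsto (fun k => ∫ x, c k * V x * inner ℝ (expVec k (p x)) (trialVec δ z₁ z₂ k) *
        inner ℝ (expVec k (p x)) (trialVec δ z₁ z₂ k) ∂ν) (𝓝[>] 0)
        (𝓝 (∫ x, V x * (1 + δ * η x) * (1 + δ * η x) ∂ν)) := by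
      refine tendsto_integral_filter_of_dominated_convergence (fun x => |V x| * D * D) ?_ ?_ ?_ ?_
      · filter_upwards [self_mem_nhdsWithin] with k hk
        have hi : Measurable fun x => inner ℝ (expVec k (p x)) (trialVec δ z₁ z₂ k) :=
          (((continuous_expVec hk).inner continuous_const).measurable).comp hp
        exact ((hV.aestronglyMeasurable.const_mul _).mul hi.aestronglyMeasurable).mul
          hi.aestronglyMeasurable
      · filter_upwards [self_mem_nhdsWithin] with k hk
        refine Eventually.of_forall fun x => ?_
        have h1 := abs_inner_trialVec_le δ z₁ z₂ hk (p x)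
        rw [Real.norm_eq_abs, abs_mul, abs_mul, abs_mul]
        have h2 : |c k| * |V x| ≤ |V x| := mul_le_of_le_one_left (abs_nonneg _) (hcb k hk)
        gcongr
      · exact (hV.abs.mul_const _).mul_const _
      · refine Eventually.of_forall fun x => ?_
        have h1 := tendsto_inner_trialVec δ z₁ z₂ (p x)
        have h2 := ((hc1.mul_const (V x)).mul h1).mul h1
        simpa only [one_mul] using h2
    refine h.congr' ?_
    filter_upwards [self_mem_nhdsWithin] with k hk
    rw [real_inner_comm, inner_kernelOp hp hV (c k) hk]
  have hlt : δ ^ 2 * |z₁ - z₂| < ∫ x, V x * (1 + δ * η x) * (1 + δ * η x) ∂ν := by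
    rw [hlim]
    linarith
  obtain ⟨k, hk, hk0⟩ := (((tendsto_norm_trialVec_sq δ z₁ z₂).eventually_lt hQ hlt).and
    self_mem_nhdsWithin).exists
  exact ⟨k, hk0, _, hk⟩

/-- For some rate `k > 0`, the integral equation with exponential kernel has a bounded
continuous solution which does not vanish identically on the range of `p`. -/
theorem exists_kernel_solution (hp : Measurable p) (hV : Integrable V ν)
    (hV0 : 0 ≤ ∫ x, V x ∂ν)
    (hnd : ∃ z₁ z₂, ∫ x, V x * (|z₂ - p x| - |z₁ - p x|) ∂ν ≠ 0) {c : ℝ → ℝ}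
    (hc : ContinuousOn c (Ioi 0))
    (hc1 : Tendsto c (𝓝[>] 0) (𝓝 1)) (hcb : ∀ k, 0 < k → |c k| ≤ 1) :
    ∃ k, 0 < k ∧ ∃ ψ : ℝ → ℝ, Continuous ψ ∧ (∃ C, ∀ t, |ψ t| ≤ C) ∧ (∃ x, ψ (p x) ≠ 0) ∧
      ∀ t, ψ t = c k / (2 * k) * ∫ x, Real.exp (-(k * |t - p x|)) * (V x * ψ (p x)) ∂ν := by
  have hlarge : ∀ k, 0 < k → ∫ x, |V x| ∂ν ≤ k → ‖kernelOp ν p V (c k) k‖ ≤ 1 := by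
    intro k hk hle
    refine (norm_kernelOp_le (c k) hk).trans ?_
    rw [div_le_one (by positivity)]
    have h0 : 0 ≤ ∫ x, |V x| ∂ν := integral_nonneg fun _ => abs_nonneg _
    nlinarith [hcb k hk, abs_nonneg (c k)]
  obtain ⟨k, hk, u, hu0, hu⟩ := exists_fixed_of_family (fun k => kernelOp ν p V (c k) k)
    (continuousOn_kernelOp hp hV hc) (fun k hk => isCompactOperator_kernelOp hp hV (c k) hk)
    (fun k hk => kernelOp_symm hp hV (c k) hk) _ hlarge
    (exists_kernelOp_gt hp hV hV0 hnd hc1 hcb)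
  refine ⟨k, hk, fun t => inner ℝ (expVec k t) u, (continuous_expVec hk).inner continuous_const,
    ⟨√(1 / (2 * k)) * ‖u‖, fun t => ?_⟩, ?_, fun t => ?_⟩
  · rw [← norm_expVec_sq hk t, Real.sqrt_sq (norm_nonneg _)]
    exact abs_real_inner_le_norm _ _
  -- If `ψ` vanished on the range of `p`, the operator would send `u` to `0`, so `u = 0`.
  -- Nonvanishing on the range is what survives restriction to the integers.
  · by_contra! h
    rw [kernelOp_apply hp hV (c k) hk] at hu
    simp only [h] at hu
    simp at hu
    exact hu0 hu.symm
  · change inner ℝ (expVec k t) u = _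
    conv_lhs => rw [← hu]
    rw [inner_kernelOp hp hV (c k) hk, ← integral_const_mul]
    congr 1
    funext x
    rw [inner_expVec hk, abs_sub_comm]
    ring

end Kernel

/-! ### Kernel regularity and nondegeneracy on the line -/

section Line

theorem lipschitz_kernel_mul {G : ℝ → ℝ} {L : ℝ}
    (hG : ∀ s t z : ℝ, |G (s - z) - G (t - z)| ≤ L * |s - t|)
    (h : ℝ → ℝ) (z : ℝ) : LipschitzOnWith (Real.nnabs (L * |h z|)) (fun s => G (s - z) * h z)
      univ := by
  refine LipschitzOnWith.of_dist_le_mul fun s _ t _ => ?_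
  rw [Real.dist_eq, Real.dist_eq, ← sub_mul, abs_mul, Real.coe_nnabs]
  calc _ ≤ L * |s - t| * |h z| := by gcongr; exact hG s t z
    _ = L * |h z| * |s - t| := by ring
    _ ≤ _ := by gcongr; exact le_abs_self _

/-- Differentiation of `t ↦ ∫ G(t - z) h(z) dz` for a Lipschitz kernel with a corner. -/
theorem hasDerivAt_integral_kernel {G G' : ℝ → ℝ} {L : ℝ}
    (hG : ∀ s t z : ℝ, |G (s - z) - G (t - z)| ≤ L * |s - t|)
    (hG' : Measurable G') (hGG' : ∀ s, s ≠ 0 → HasDerivAt G (G' s) s) {h : ℝ → ℝ}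
    (hh : Integrable h) {t : ℝ} (hint : Integrable fun z => G (t - z) * h z) :
    HasDerivAt (fun s => ∫ z, G (s - z) * h z) (∫ z, G' (t - z) * h z) t := by
  have hGc : Continuous G := by
    refine (LipschitzWith.of_dist_le_mul (K := Real.nnabs L) fun s t => ?_).continuous
    have := hG s t 0
    rw [sub_zero, sub_zero] at this
    rw [Real.dist_eq, Real.dist_eq, Real.coe_nnabs]
    exact this.trans (by gcongr; exact le_abs_self _)
  refine (hasDerivAt_integral_of_dominated_loc_of_lip (bound := fun z => L * |h z|) univ_mem
    (Eventually.of_forall fun s => ?_) hint ?_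
    (Eventually.of_forall fun z => lipschitz_kernel_mul hG h z) (hh.abs.const_mul L) ?_).2
  · exact (hGc.comp (by fun_prop : Continuous fun z => s - z)).aestronglyMeasurable.mul
      hh.aestronglyMeasurable
  · exact (hG'.comp (by fun_prop : Measurable fun z => t - z)).aestronglyMeasurable.mul
      hh.aestronglyMeasurable
  -- The corner of `G` only affects the null set `z = t`.
  · filter_upwards [compl_mem_ae_iff.2 (measure_singleton (μ := volume) t)] with z hz
    have hz : z ≠ t := hz
    have := (hGG' (t - z) (sub_ne_zero.2 hz.symm)).comp t ((hasDerivAt_id t).sub_const z)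
    simpa using this.mul_const (h z)

theorem hasDerivAt_abs_ite {s : ℝ} (h : s ≠ 0) :
    HasDerivAt (fun s => |s|) (if 0 < s then 1 else -1) s := by
  split_ifs with hz
  · exact (hasDerivAt_id s).congr_of_eventuallyEq
      ((lt_mem_nhds hz).mono fun s hs => abs_of_pos hs)
  · exact (hasDerivAt_neg s).congr_of_eventuallyEq
      ((gt_mem_nhds (lt_of_le_of_ne (not_lt.1 hz) h)).mono fun s hs => abs_of_neg hs)

/-- A potential whose convolution with `|x|` is constant vanishes. -/
theorem exists_integral_abs_sub_ne_zero {V : ℝ → ℝ} (hV : Integrable V)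
    (hxV : Integrable fun x => |x| * V x) (hne : ¬ V =ᵐ[volume] 0) :
    ∃ z₁ z₂ : ℝ, ∫ x, V x * (|z₂ - x| - |z₁ - x|) ≠ 0 := by
  by_contra! hall
  apply hne
  have hint : ∀ t : ℝ, Integrable fun z => |t - z| * V z := by
    intro t
    refine ((hV.abs.const_mul |t|).add hxV.abs).mono'
      ((by fun_prop : Continuous fun z => |t - z|).aestronglyMeasurable.mul
        hV.aestronglyMeasurable) (Eventually.of_forall fun z => ?_)
    simp only [Real.norm_eq_abs, abs_mul, abs_abs, Pi.add_apply]
    rw [← add_mul]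
    gcongr
    exact abs_sub t z
  have hconst : ∀ t : ℝ, ∫ z, |t - z| * V z = ∫ z, |0 - z| * V z := by
    intro t
    rw [← sub_eq_zero, ← integral_sub (hint t) (hint 0)]
    refine Eq.trans ?_ (hall 0 t)
    congr 1
    funext z
    ring
  have hsgn : ∀ t : ℝ, ∫ z, (if 0 < t - z then (1 : ℝ) else -1) * V z = 0 := by
    intro t
    have h := hasDerivAt_integral_kernel (G := fun s => |s|) (L := 1)
      (G' := fun s => if 0 < s then 1 else -1) (fun s t z => ?_)
      (Measurable.ite measurableSet_Ioi measurable_const measurable_const)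
      (fun s hs => hasDerivAt_abs_ite hs) hV (hint t)
    · rw [funext hconst] at h
      exact h.unique (hasDerivAt_const t _)
    · have := abs_abs_sub_abs_le_abs_sub (s - z) (t - z)
      rwa [sub_sub_sub_cancel_right, ← one_mul |s - t|] at this
  -- The sign kernel is twice the indicator of `z < t` minus one. The left-tail integral is thus
  -- independent of `t`, and Lebesgue differentiation gives `V = 0` almost everywhere.
  have hIio : ∀ t : ℝ, 2 * ∫ z in Iio t, V z = ∫ z, V z := by
    intro t
    rw [← integral_indicator measurableSet_Iio, ← integral_const_mul, ← sub_eq_zero,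
      ← integral_sub ((hV.indicator measurableSet_Iio).const_mul 2) hV, ← hsgn t]
    congr 1
    funext z
    by_cases hz : z < t <;> simp [hz]
    ring
  have hzero : ∀ t : ℝ, ∫ z in (0 : ℝ)..t, V z = 0 := by
    intro t
    rw [← intervalIntegral.integral_Iio_sub_Iio' hV.integrableOn hV.integrableOn]
    linarith [hIio t, hIio 0]
  filter_upwards [_root_.LocallyIntegrable.ae_hasDerivAt_integral hV.locallyIntegrable] with x hx
  have h := hx 0
  rw [funext hzero] at h
  exact h.unique (hasDerivAt_const x _)

theorem integrable_exp_neg_mul_abs {k : ℝ} (hk : 0 < k) :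
    Integrable fun x : ℝ => Real.exp (-(k * |x|)) := by
  rw [← integrableOn_univ, ← Iic_union_Ioi (a := (0 : ℝ))]
  refine IntegrableOn.union ?_ ?_
  · refine (integrableOn_exp_mul_Iic hk 0).congr_fun (fun x hx => ?_) measurableSet_Iic
    simp [abs_of_nonpos (show x ≤ 0 from hx)]
  · refine (exp_neg_integrableOn_Ioi 0 hk).congr_fun (fun x hx => ?_) measurableSet_Ioi
    simp [abs_of_pos (show 0 < x from hx)]

theorem integrable_exp_kernel {k C : ℝ} (hk : 0 < k) {h ψ : ℝ → ℝ} (hh : Integrable h)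
    (hψ : ∀ t, ψ t = C * ∫ z, Real.exp (-(k * |t - z|)) * h z) : Integrable ψ := by
  have h1 := (hh.integrable_convolution (ContinuousLinearMap.mul ℝ ℝ)
    (integrable_exp_neg_mul_abs hk)).const_mul C
  refine h1.congr (Eventually.of_forall fun t => ?_)
  simp only [convolution_def, ContinuousLinearMap.mul_apply', hψ t]
  simp only [mul_comm (h _)]

/-- Regularity of `C exp (-k |·|) ⋆ h`, and the differential equation which it satisfies. -/
theorem exists_deriv_exp_kernel {k C : ℝ} (hk : 0 < k) {h ψ : ℝ → ℝ} (hh : Integrable h)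
    (hψ : ∀ t, ψ t = C * ∫ z, Real.exp (-(k * |t - z|)) * h z) :
    ∃ φ : ℝ → ℝ, (∀ x, HasDerivAt ψ (φ x) x) ∧ (∀ a b, AbsolutelyContinuousOnInterval φ a b) ∧
      ∀ᵐ x, HasDerivAt φ (k ^ 2 * ψ x - 2 * k * C * h x) x := by
  set G : ℝ → ℝ := fun s => Real.exp (-(k * |s|)) with hG
  have hGc : Continuous G := by fun_prop
  have hGlip : ∀ s t z : ℝ, |G (s - z) - G (t - z)| ≤ k * |s - t| :=
    fun s t z => abs_exp_abs_sub_le hk.le s t z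
  have hGint : ∀ t : ℝ, Integrable fun z => G (t - z) * h z := by
    intro t
    refine hh.bdd_mul (c := 1) (by fun_prop : Continuous fun z => G (t - z)).aestronglyMeasurable
      (Eventually.of_forall fun z => ?_)
    rw [Real.norm_eq_abs, Real.abs_exp]
    exact Real.exp_le_one_iff.2 (neg_nonpos.2 (by positivity))
  set g : ℝ → ℝ := fun z => Real.exp (-(k * z)) * h z with hg
  have hgloc : LocallyIntegrable g := by
    have hc : Continuous fun z : ℝ => Real.exp (-(k * z)) := by fun_prop
    exact hh.locallyIntegrable.continuous_mul hc
  have hgIci : ∀ t : ℝ, IntegrableOn g (Ici t) := by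
    intro t
    refine (hh.abs.const_mul (Real.exp (-(k * t)))).integrableOn.mono'
      hgloc.aestronglyMeasurable.restrict
      ((ae_restrict_iff' measurableSet_Ici).2 (Eventually.of_forall fun z hz => ?_))
    have hz : t ≤ z := hz
    rw [hg, Real.norm_eq_abs, abs_mul, Real.abs_exp]
    gcongr
  -- Since `G' = -k G` plus `2 k exp (k s)` on `s ≤ 0`, one gets `ψ' = -k ψ + 2 k C exp (k t) B`.
  -- Absolute continuity of `ψ'` then rests on that of the tail integral `B`.
  set B : ℝ → ℝ := fun t => ∫ z in Ici t, g z with hB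
  have hBeq : ∀ t, B t = B 0 - ∫ z in (0 : ℝ)..t, g z := by
    intro t
    rw [← intervalIntegral.integral_Ici_sub_Ici' (hgIci 0) (hgIci t)]
    ring
  have hBac : ∀ a b, AbsolutelyContinuousOnInterval B a b := by
    intro a b
    rw [funext hBeq]
    have hI : AbsolutelyContinuousOnInterval (fun t => ∫ z in (0 : ℝ)..t, g z) a b := by
      -- The interval is enlarged to contain the base point `0` of the primitive.
      refine AbsolutelyContinuousOnInterval.mono (a := min a (min b 0)) (b := max a (max b 0))
        (IntervalIntegrable.absolutelyContinuousOnInterval_intervalIntegral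
          (hgloc.integrableOn_isCompact isCompact_uIcc).intervalIntegrable ?_) ?_
      · rw [uIcc_of_le (by simp)]
        simp
      · rw [uIcc_of_le (a := min a (min b 0)) (by simp)]
        exact uIcc_subset_Icc (by simp) (by simp)
    exact AbsolutelyContinuousOnInterval.fun_sub
      ((LipschitzWith.const (B 0)).lipschitzOnWith.absolutelyContinuousOnInterval) hI
  have hderiv : ∀ t, HasDerivAt ψ (-k * ψ t + 2 * k * C * (Real.exp (k * t) * B t)) t := by
    intro t
    have h1 := hasDerivAt_integral_kernel (L := k) hGlip
      (G' := fun s => -k * G s + 2 * k * (if s ≤ 0 then Real.exp (k * s) else 0))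
      (((hGc.measurable.const_mul _)).add ((Measurable.ite measurableSet_Iic
        (by fun_prop) measurable_const).const_mul _))
      (fun s hs => ?_) hh (hGint t)
    · refine ((h1.const_mul C).congr_of_eventuallyEq (Eventually.of_forall hψ)).congr_deriv ?_
      have hind : ∀ z, (if t - z ≤ 0 then Real.exp (k * (t - z)) else 0) * h z =
          Real.exp (k * t) * (Ici t).indicator g z := by
        intro z
        by_cases hz : t ≤ z
        · simp only [sub_nonpos, hz, if_true, indicator_of_mem (show z ∈ Ici t from hz), hg]
          rw [← mul_assoc, ← Real.exp_add]
          ring_nf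
        · simp [hz]
      have hsplit : ∀ z, (-k * G (t - z) + 2 * k * (if t - z ≤ 0 then Real.exp (k * (t - z)) else 0))
          * h z = -k * (G (t - z) * h z) + 2 * k * (Real.exp (k * t) * (Ici t).indicator g z) := by
        intro z
        rw [← hind z]
        ring
      rw [integral_congr_ae (Eventually.of_forall hsplit)]
      have hi := (integrable_indicator_iff measurableSet_Ici).2 (hgIci t)
      rw [integral_add ((hGint t).const_mul _) ((hi.const_mul _).const_mul _),
        integral_const_mul, integral_const_mul, integral_const_mul,
        integral_indicator measurableSet_Ici, hψ t]
      ring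
    · have h3 := ((hasDerivAt_abs_ite hs).const_mul k).neg.exp
      convert! h3 using 1
      rcases lt_or_gt_of_ne hs with hs | hs
      · simp [hG, not_lt.2 hs.le, hs.le, abs_of_neg hs]
        ring
      · simp [hG, hs, not_le.2 hs]
        ring
  have hψlip : ∀ s t, |ψ s - ψ t| ≤ |C| * (k * ∫ z, |h z|) * |s - t| := by
    intro s t
    rw [hψ, hψ, ← mul_sub, abs_mul, ← integral_sub (hGint s) (hGint t), mul_assoc]
    refine mul_le_mul_of_nonneg_left ?_ (abs_nonneg C)
    refine (abs_integral_le_integral_abs).trans ?_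
    rw [mul_assoc, mul_comm _ |s - t|, ← mul_assoc, ← integral_const_mul]
    refine integral_mono ((hGint s).sub (hGint t)).abs (hh.abs.const_mul _) fun z => ?_
    change |G (s - z) * h z - G (t - z) * h z| ≤ _
    rw [← sub_mul, abs_mul]
    exact mul_le_mul_of_nonneg_right (hGlip s t z) (abs_nonneg _)
  have hψac : ∀ a b, AbsolutelyContinuousOnInterval ψ a b := fun a b =>
    (LipschitzWith.of_dist_le_mul (K := ⟨|C| * (k * ∫ z, |h z|), by positivity⟩)
      hψlip).lipschitzOnWith.absolutelyContinuousOnInterval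
  refine ⟨_, hderiv, fun a b => ?_, ?_⟩
  · refine ((hψac a b).const_mul (-k)).fun_add
      (AbsolutelyContinuousOnInterval.const_mul _ (AbsolutelyContinuousOnInterval.fun_mul ?_ (hBac a b)))
    have hcd : ContDiff ℝ 1 fun t : ℝ => Real.exp (k * t) := by fun_prop
    exact hcd.contDiffOn.absolutelyContinuousOnInterval
  · filter_upwards [_root_.LocallyIntegrable.ae_hasDerivAt_integral hgloc] with x hx
    have hB' : HasDerivAt B (-g x) x := by
      rw [funext hBeq]
      exact (hx 0).const_sub _
    have he : HasDerivAt (fun t => Real.exp (k * t)) (Real.exp (k * x) * k) x := by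
      simpa using ((hasDerivAt_id x).const_mul k).exp
    -- The two `B` terms cancel, leaving `k ^ 2 ψ` and the source.
    have h4 := ((hderiv x).const_mul (-k)).add ((he.mul hB').const_mul (2 * k * C))
    convert! h4 using 1
    have : Real.exp (k * x) * g x = h x := by
      rw [hg, ← mul_assoc, ← Real.exp_add]
      simp
    linear_combination (2 * k * C) * this

end Line

/-! ### The eigenvalue on the line -/

theorem AbsolutelyContinuousOnInterval.complex_ofReal {f : ℝ → ℝ} {a b : ℝ}
    (hf : AbsolutelyContinuousOnInterval f a b) :
    AbsolutelyContinuousOnInterval (fun x => (f x : ℂ)) a b := by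
  have h1 : AbsolutelyContinuousOnInterval (fun _ : ℝ => (1 : ℂ)) a b :=
    (LipschitzWith.const (1 : ℂ)).lipschitzOnWith.absolutelyContinuousOnInterval
  simpa using hf.fun_smul h1

theorem isEigenvalue_of_mem_graph {E : Type*} [AddCommGroup E] [Module ℂ E] {T : E →ₗ.[ℂ] E}
    {μ : ℂ} {f : E} (hf : f ≠ 0) (h : (f, μ • f) ∈ T.graph) : IsEigenvalue T μ := by
  obtain ⟨y, hy, hTy⟩ := (LinearPMap.mem_graph_iff T).1 h
  exact ⟨y, by rwa [hy], by rw [hTy, hy]⟩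

theorem line_exists_eigenvalue {V : ℝ → ℝ}
    (hV : Integrable (fun x => (1 + |x|) * V x) volume) (hne : ¬ (V =ᵐ[volume] 0))
    (hV0 : 0 ≤ ∫ x, V x) {σ : ℝ} (hσ : 0 < σ) :
    ∃ μ : ℝ, 0 < μ ∧ IsEigenvalue (lineSchrodinger σ V) (μ : ℂ) := by
  have hw : Continuous fun x : ℝ => (1 + |x|)⁻¹ := by
    have : Continuous fun x : ℝ => 1 + |x| := by fun_prop
    exact this.inv₀ fun x => by positivity
  have hVi : Integrable V := by
    refine (hV.bdd_mul (c := 1) hw.aestronglyMeasurable (Eventually.of_forall fun x => ?_)).congr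
      (Eventually.of_forall fun x => ?_)
    · rw [norm_inv, Real.norm_of_nonneg (by positivity)]
      exact inv_le_one_of_one_le₀ (by linarith [abs_nonneg x])
    · have : 1 + |x| ≠ 0 := by positivity
      simp [this]
  have hxV : Integrable fun x => |x| * V x := by
    refine (hV.sub hVi).congr (Eventually.of_forall fun x => ?_)
    simp only [Pi.sub_apply]
    ring
  obtain ⟨z₁, z₂, hz⟩ := exists_integral_abs_sub_ne_zero hVi hxV hne
  obtain ⟨k, hk, ψ, hψc, ⟨M, hM⟩, ⟨x₀, hx₀⟩, hψ⟩ := exists_kernel_solution (ν := volume)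
    (p := fun x : ℝ => x) (V := fun x => σ * V x) (c := fun _ => 1) measurable_id
    (hVi.const_mul σ) (by rw [integral_const_mul]; positivity)
    ⟨z₁, z₂, by simp only [mul_assoc]; rw [integral_const_mul]; exact mul_ne_zero hσ.ne' hz⟩
    continuousOn_const tendsto_const_nhds (by simp)
  have hh : Integrable fun x => σ * V x * ψ x :=
    (hVi.const_mul σ).mul_bdd (c := M) hψc.aestronglyMeasurable (Eventually.of_forall hM)
  obtain ⟨φ, hd, hac, hae⟩ := exists_deriv_exp_kernel hk hh hψ
  have hψi : Integrable ψ := integrable_exp_kernel hk hh hψ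
  -- Bounded and integrable, hence square integrable.
  have hψ2 : MemLp (fun x => (ψ x : ℂ)) 2 volume := by
    refine MemLp.ofReal ((memLp_two_iff_integrable_sq hψc.aestronglyMeasurable).2 ?_)
    simp only [sq]
    exact hψi.mul_bdd (c := M) hψc.aestronglyMeasurable (Eventually.of_forall hM)
  refine ⟨k ^ 2, by positivity, isEigenvalue_of_mem_graph (f := hψ2.toLp) (fun h0 => ?_) ?_⟩
  · have h1 : (fun x => (ψ x : ℂ)) =ᵐ[volume] fun _ => 0 :=
      hψ2.coeFn_toLp.symm.trans (h0 ▸ Lp.coeFn_zero ℂ 2 volume)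
    have h2 := ((Complex.continuous_ofReal.comp hψc).ae_eq_iff_eq volume continuous_const).1 h1
    exact hx₀ (by simpa using congrFun h2 x₀)
  · rw [lineSchrodinger_mem_graph_iff]
    refine ⟨fun x => (ψ x : ℂ), fun x => (φ x : ℂ), hψ2.coeFn_toLp,
      fun x => (hd x).ofReal_comp, fun a b => (hac a b).complex_ofReal, ?_⟩
    filter_upwards [hae, hψ2.coeFn_toLp, Lp.coeFn_smul ((k ^ 2 : ℝ) : ℂ) hψ2.toLp] with x h1 h2 h3
    rw [h3, Pi.smul_apply, h2]
    convert! h1.ofReal_comp using 1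
    rw [mul_one_div_cancel (by positivity), one_mul]
    push_cast
    ring

/-! ### The lattice case -/

section Lattice

theorem integral_count_single {f : ℤ → ℝ} (n : ℤ) :
    ∫ z, (if z = n then f z else 0) ∂Measure.count = f n := by
  have hs : Summable fun z => ‖if z = n then f z else 0‖ :=
    summable_of_ne_finset_zero (s := {n}) fun z hz => by
      simp [Finset.notMem_singleton.1 hz]
  rw [integral_countable (integrable_count_iff.2 hs), tsum_eq_single n fun z hz => by simp [hz]]
  simp

/-- On each side of `0` the exponential is an eigenfunction of the second difference; the corner at
`0` leaves a point source of mass `2 sinh k`, which fixes the Green function's normalisation. -/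
theorem exp_kernel_second_difference (k : ℝ) (n : ℤ) :
    Real.exp (-(k * |(n : ℝ) - 1|)) + Real.exp (-(k * |(n : ℝ) + 1|)) -
      2 * Real.exp (-(k * |(n : ℝ)|)) = (2 * Real.cosh k - 2) * Real.exp (-(k * |(n : ℝ)|)) -
        if n = 0 then 2 * Real.sinh k else 0 := by
  have hc : 2 * Real.cosh k = Real.exp k + Real.exp (-k) := by rw [Real.cosh_eq]; ring
  have hs : 2 * Real.sinh k = Real.exp k - Real.exp (-k) := by rw [Real.sinh_eq]; ring
  rw [hc, hs]
  rcases lt_trichotomy n 0 with h | rfl | h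
  · have h1 : (n : ℝ) + 1 ≤ 0 := by exact_mod_cast h
    rw [abs_of_nonpos h1, abs_of_nonpos (by linarith), abs_of_nonpos (by linarith), if_neg h.ne,
      show -(k * -((n : ℝ) - 1)) = -(k * -n) + -k by ring,
      show -(k * -((n : ℝ) + 1)) = -(k * -n) + k by ring, Real.exp_add, Real.exp_add]
    ring
  · simp
    ring
  · have h1 : 1 ≤ (n : ℝ) := by exact_mod_cast h
    rw [abs_of_nonneg (by linarith), abs_of_nonneg (by linarith), abs_of_nonneg (by linarith),
      if_neg h.ne', show -(k * ((n : ℝ) - 1)) = -(k * n) + k by ring,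
      show -(k * ((n : ℝ) + 1)) = -(k * n) + -k by ring, Real.exp_add, Real.exp_add]
    ring

theorem abs_second_difference (n : ℤ) :
    |(n : ℝ) - 1| + |(n : ℝ) + 1| - 2 * |(n : ℝ)| = if n = 0 then 2 else 0 := by
  rcases lt_trichotomy n 0 with h | rfl | h
  · have h1 : (n : ℝ) + 1 ≤ 0 := by exact_mod_cast h
    rw [abs_of_nonpos h1, abs_of_nonpos (by linarith), abs_of_nonpos (by linarith), if_neg h.ne]
    ring
  · norm_num
  · have h1 : 1 ≤ (n : ℝ) := by exact_mod_cast h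
    rw [abs_of_nonneg (by linarith), abs_of_nonneg (by linarith), abs_of_nonneg (by linarith),
      if_neg h.ne']
    ring

theorem exists_lattice_integral_abs_sub_ne_zero {V : ℤ → ℝ} (hV : Integrable V Measure.count)
    (hne : V ≠ 0) :
    ∃ z₁ z₂ : ℝ, ∫ x : ℤ, V x * (|z₂ - x| - |z₁ - x|) ∂Measure.count ≠ 0 := by
  by_contra! hall
  apply hne
  funext n
  have hi : ∀ z₁ z₂ : ℝ, Integrable (fun x : ℤ => V x * (|z₂ - x| - |z₁ - x|)) Measure.count := by
    intro z₁ z₂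
    refine hV.mul_bdd (c := |z₂ - z₁|) (measurable_of_countable _).aestronglyMeasurable
      (Eventually.of_forall fun x => ?_)
    have := abs_abs_sub_abs_le_abs_sub (z₂ - x) (z₁ - x)
    rwa [sub_sub_sub_cancel_right] at this
  -- The two differences add up to a second difference of `|· - x|` at `n`, which is `2` at `x = n`
  -- and `0` elsewhere; so the sum isolates `2 V n`.
  have h := integral_add (hi n (n - 1)) (hi n (n + 1))
  rw [hall, hall, add_zero] at h
  have h2 : ∀ x : ℤ, V x * (|(n : ℝ) - 1 - x| - |(n : ℝ) - x|) +
      V x * (|(n : ℝ) + 1 - x| - |(n : ℝ) - x|) = if x = n then V x * 2 else 0 := by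
    intro x
    have h3 := abs_second_difference (n - x)
    push_cast at h3
    rw [sub_right_comm (n : ℝ) 1, add_sub_right_comm (n : ℝ) 1]
    by_cases hx : x = n
    · rw [if_pos (by omega)] at h3
      rw [if_pos hx]
      linear_combination V x * h3
    · rw [if_neg (by omega)] at h3
      rw [if_neg hx]
      linear_combination V x * h3
  simp only [h2] at h
  rw [integral_count_single (f := fun x => V x * 2)] at h
  simpa using h

theorem integrable_count_exp_neg_mul_abs {k : ℝ} (hk : 0 < k) :
    Integrable (fun n : ℤ => Real.exp (-(k * |(n : ℝ)|))) Measure.count := by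
  rw [integrable_count_iff]
  simp only [Real.norm_eq_abs, Real.abs_exp]
  have h : Summable fun n : ℕ => Real.exp (n * -k) := Real.summable_exp_nat_mul_iff.2 (by linarith)
  refine Summable.of_nat_of_neg (h.congr fun n => ?_) (h.congr fun n => ?_) <;>
  simp [mul_comm]

theorem integrable_count_exp_kernel {k C : ℝ} (hk : 0 < k) {h : ℤ → ℝ} {ψ : ℤ → ℝ}
    (hh : Integrable h Measure.count)
    (hψ : ∀ t : ℤ, ψ t = C * ∫ z : ℤ, Real.exp (-(k * |(t : ℝ) - z|)) * h z ∂Measure.count) :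
    Integrable ψ Measure.count := by
  have h1 := (hh.integrable_convolution (ContinuousLinearMap.mul ℝ ℝ)
    (integrable_count_exp_neg_mul_abs hk)).const_mul C
  refine h1.congr (Eventually.of_forall fun t => ?_)
  simp only [convolution_def, ContinuousLinearMap.mul_apply', hψ t]
  simp only [mul_comm (h _), Int.cast_sub]

theorem exp_kernel_lattice_equation {k C : ℝ} (hk : 0 < k) {h : ℤ → ℝ} {ψ : ℤ → ℝ}
    (hh : Integrable h Measure.count)
    (hψ : ∀ t : ℤ, ψ t = C * ∫ z : ℤ, Real.exp (-(k * |(t : ℝ) - z|)) * h z ∂Measure.count)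
    (n : ℤ) : ψ (n - 1) + ψ (n + 1) - 2 * ψ n =
      (2 * Real.cosh k - 2) * ψ n - 2 * C * Real.sinh k * h n := by
  have hi : ∀ t : ℤ, Integrable (fun z : ℤ => Real.exp (-(k * |(t : ℝ) - z|)) * h z)
      Measure.count := by
    intro t
    refine hh.bdd_mul (c := 1) (measurable_of_countable _).aestronglyMeasurable
      (Eventually.of_forall fun z => ?_)
    rw [Real.norm_eq_abs, Real.abs_exp]
    exact Real.exp_le_one_iff.2 (neg_nonpos.2 (by positivity))
  have h1 := integral_sub ((hi (n - 1)).add (hi (n + 1))) ((hi n).const_mul (2 * Real.cosh k))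
  simp only [Pi.add_apply] at h1
  rw [integral_add (hi (n - 1)) (hi (n + 1)), integral_const_mul] at h1
  have h2 : ∀ z : ℤ, Real.exp (-(k * |((n - 1 : ℤ) : ℝ) - z|)) * h z +
      Real.exp (-(k * |((n + 1 : ℤ) : ℝ) - z|)) * h z -
      2 * Real.cosh k * (Real.exp (-(k * |(n : ℝ) - z|)) * h z) =
      if z = n then -(2 * Real.sinh k) * h z else 0 := by
    intro z
    have h3 := exp_kernel_second_difference k (n - z)
    push_cast at h3 ⊢
    rw [sub_right_comm (n : ℝ) 1, add_sub_right_comm (n : ℝ) 1]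
    by_cases hz : z = n
    · rw [if_pos (by omega)] at h3
      rw [if_pos hz]
      linear_combination h z * h3
    · rw [if_neg (by omega)] at h3
      rw [if_neg hz]
      linear_combination h z * h3
  simp only [h2] at h1
  rw [integral_count_single (f := fun z => -(2 * Real.sinh k) * h z)] at h1
  rw [hψ, hψ, hψ]
  linear_combination -C * h1

theorem tendsto_div_sinh : Tendsto (fun k => k / Real.sinh k) (𝓝[>] 0) (𝓝 1) := by
  have h := (Real.hasDerivAt_sinh 0).tendsto_slope_zero_right
  simp only [zero_add, Real.sinh_zero, sub_zero, Real.cosh_zero, smul_eq_mul] at h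
  have h2 := h.inv₀ one_ne_zero
  rw [inv_one] at h2
  refine h2.congr fun k => ?_
  rw [mul_inv, inv_inv, div_eq_mul_inv]

/-- The factor `k / sinh k` turns the continuous normalisation `1 / (2k)` into `1 / (2 sinh k)`. It
lies in `(0, 1]` because `k ≤ sinh k`, and tends to `1`, so the small-`k` analysis is unchanged. -/
theorem lattice_exists_eigenvalue {V : ℤ → ℝ}
    (hV : Summable (fun x : ℤ => (1 + |(x : ℝ)|) * |V x|)) (hne : V ≠ 0)
    (hV0 : 0 ≤ ∑' x, V x) {σ : ℝ} (hσ : 0 < σ) :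
    ∃ μ : ℝ, 0 < μ ∧ IsEigenvalue (latticeSchrodinger σ V) (μ : ℂ) := by
  have hVi : Integrable V Measure.count := by
    rw [integrable_count_iff]
    refine hV.of_nonneg_of_le (fun _ => norm_nonneg _) fun x => ?_
    rw [Real.norm_eq_abs]
    nlinarith [abs_nonneg (V x), abs_nonneg (x : ℝ)]
  have hV0' : 0 ≤ ∫ x, V x ∂Measure.count := by
    rw [integral_countable hVi]
    simpa using hV0
  obtain ⟨z₁, z₂, hz⟩ := exists_lattice_integral_abs_sub_ne_zero hVi hne
  obtain ⟨k, hk, ψ, hψc, ⟨M, hM⟩, ⟨x₀, hx₀⟩, hψ⟩ := exists_kernel_solution (ν := Measure.count)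
    (p := fun x : ℤ => (x : ℝ)) (V := fun x => σ * V x) (c := fun k => k / Real.sinh k)
    (measurable_of_countable _)
    (hVi.const_mul σ) (by rw [integral_const_mul]; positivity)
    ⟨z₁, z₂, by simp only [mul_assoc]; rw [integral_const_mul]; exact mul_ne_zero hσ.ne' hz⟩
    (continuousOn_id.div Real.continuous_sinh.continuousOn
      fun k hk => (Real.sinh_pos_iff.2 hk).ne')
    tendsto_div_sinh (fun k hk => by
      have h := Real.sinh_pos_iff.2 hk
      rw [abs_of_pos (by positivity), div_le_one h]
      exact Real.self_le_sinh_iff.2 hk.le)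
  have hs := Real.sinh_pos_iff.2 hk
  have hh : Integrable (fun x : ℤ => σ * V x * ψ x) Measure.count :=
    (hVi.const_mul σ).mul_bdd (c := M) (measurable_of_countable _).aestronglyMeasurable
      (Eventually.of_forall fun x => hM x)
  have heq := exp_kernel_lattice_equation hk (ψ := fun n : ℤ => ψ n) hh fun t => hψ t
  have hψi := integrable_count_exp_kernel hk (ψ := fun n : ℤ => ψ n) hh fun t => hψ t
  have hmem : Memℓp (fun n : ℤ => (ψ n : ℂ)) 2 := by
    -- Summability suffices, since `ℓ¹ ⊆ ℓ²`.
    refine Memℓp.of_exponent_ge (p := 2) (q := 1) (memℓp_gen ?_) (by norm_num)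
    simpa using integrable_count_iff.1 hψi
  set f : L2Lattice := ⟨fun n : ℤ => (ψ n : ℂ), hmem⟩ with hf
  have hfn : ∀ n : ℤ, f n = (ψ n : ℂ) := fun n => rfl
  refine ⟨2 * Real.cosh k - 2, by linarith [Real.one_lt_cosh.2 hk.ne'],
    isEigenvalue_of_mem_graph (f := f) (fun h0 => ?_) ?_⟩
  · have h1 := hfn x₀
    rw [h0] at h1
    exact hx₀ (by simpa using h1.symm)
  · rw [latticeSchrodinger_mem_graph_iff]
    intro n
    have h1 := heq n
    have hC : 2 * (k / Real.sinh k / (2 * k)) * Real.sinh k = 1 := by field_simp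
    rw [hC, one_mul] at h1
    rw [lp.coeFn_smul, Pi.smul_apply, hfn, hfn, hfn, smul_eq_mul]
    have h2 : ((2 * Real.cosh k - 2) * ψ n : ℝ) = ψ ((n - 1 : ℤ) : ℝ) + ψ ((n + 1 : ℤ) : ℝ) -
        2 * ψ n + σ * V n * ψ n := by linarith
    have h3 := congrArg (fun r : ℝ => (r : ℂ)) h2
    push_cast at h3 ⊢
    exact h3

end Lattice

theorem mainTheorem7 :
    (∀ V : ℝ → ℝ, Integrable (fun x => (1 + |x|) * V x) volume → ¬ (V =ᵐ[volume] 0) →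
      0 ≤ ∫ x, V x →
      ∀ σ : ℝ, 0 < σ → ∃ μ : ℝ, 0 < μ ∧ IsEigenvalue (lineSchrodinger σ V) (μ : ℂ)) ∧
    (∀ V : ℤ → ℝ, Summable (fun x : ℤ => (1 + |(x : ℝ)|) * |V x|) → V ≠ 0 →
      0 ≤ ∑' x, V x →
      ∀ σ : ℝ, 0 < σ → ∃ μ : ℝ, 0 < μ ∧ IsEigenvalue (latticeSchrodinger σ V) (μ : ℂ)) :=
  ⟨fun _ hV hne hV0 _ hσ => line_exists_eigenvalue hV hne hV0 hσ,
    fun _ hV hne hV0 _ hσ => lattice_exists_eigenvalue hV hne hV0 hσ⟩
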